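/- Let $n,m,\lambda\ge 0$ and let $$\Sigma:\quad \mathbf x'=\mathbf f(\mathbf x,\boldsymbol\mu,u),\qquad \mathbf y=\mathbf g(\mathbf x,\boldsymbol\mu,u),\qquad \mathbf x(0)=\mathbf x^*$$ be an algebraic differential model with states $\mathbf x=(x_1,\dots,x_n)$, outputs $\mathbf y=(y_1,\dots,y_m)$, system parameters $\boldsymbol\mu=(\mu_1,\dots,\mu_\lambda)$, one scalar input $u$, and rational functions $f_i,g_k\in\mathbb C(\mathbf x,\boldsymbol\mu,u)$. Its parameters are $\boldsymbol\theta=(\boldsymbol\mu,\mathbf x^*)$; their number is $s=\lambda+n$. Let $Q$ be the least common multiple of the (reduced) denominators of all $f_i$ and $g_k$, and put $F_i=Qf_i$, $G_k=Qg_k\in\mathbb C[\mathbf x,\boldsymbol\mu,u]$. Let $\mathcal R=\mathbb C[\boldsymbol\mu]\{\mathbf x,\mathbf y,u\}$ be the ring of differential polynomials, with derivation satisfying $\boldsymbol\mu'=0$. For $\mathbf h=(h_1,\dots,h_m)\in\mathbb Z_{\ge0}^m$, let $\mathcal S_{\mathbf h}\subset\mathcal R$ be the smallest set such that * $(Qy_k-G_k)^{(j)}\in\mathcal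 S_{\mathbf h}$ for $1\le k\le m$ and $0\le j<h_k$; * if $x_i^{(j)}$ with $1\le i\le n$ and $j\ge1$ appears in some element of $\mathcal S_{\mathbf h}$, then $(Qx_i'-F_i)^{(j-1)}\in\mathcal S_{\mathbf h}$. Let $\mathrm{State}(\mathbf h)_i=\max\{\mathrm{ord}_{x_i}P\mid P\in\mathcal S_{\mathbf h}\}+1$ and $\mathrm{In}(\mathbf h)=\max\{\mathrm{ord}_uP\mid P\in\mathcal S_{\mathbf h}\}+1$, where the order is $-1$ if no derivative of the variable appears, and the maximum over the empty set is $-1$. Put $$\mathbf y_{\mathbf h}=\{y_k^{(j)}\mid 0\le j<h_k\},\quad \mathbf x_{\mathrm{State}(\mathbf h)}=\{x_i^{(j)}\mid 0\le j<\mathrm{State}(\mathbf h)_i\},\quad u_{\mathrm{In}(\mathbf h)}=\{u^{(j)}\mid 0\le j<\mathrm{In}(\mathbf h)\},$$ $$\mathcal R_{\mathbf h}=\mathbb C[\boldsymbol\mu,\mathbf x_{\mathrm{State}(\mathbf h)},\mathbf y_{\mathbf h},u_{\mathrm{In}(\mathbf h)}],\qquad \mathcal J_{\mathbf h}=(\mathcal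 S_{\mathbf h}):Q^\infty=\{r\in\mathcal R_{\mathbf h}\mid Q^Nr\in(\mathcal S_{\mathbf h})\text{ for some }N\ge0\}$$ (if $\mathcal S_{\mathbf h}=\varnothing$, then $\mathcal J_{\mathbf h}=0$), and let $Z_{\mathbf h}$ be the zero set of $\mathcal J_{\mathbf h}$ in the complex affine space with the variables of $\mathcal R_{\mathbf h}$ as coordinates. The projection of $Z_{\mathbf h}$ to the $(\mathbf y_{\mathbf h},u_{\mathrm{In}(\mathbf h)})$-coordinates is called dominant if its image is Zariski dense in the affine space with these coordinates. Let $\mathbf 1_i$ denote the $i$-th standard basis vector of $\mathbb Z^m$. Consider the following requirements on $\mathbf h$. (a) The projection of $Z_{\mathbf h}$ to the $(\mathbf y_{\mathbf h},u_{\mathrm{In}(\mathbf h)})$-coordinates is dominant. (b) For every $1\le i\le m$, the projection of $Z_{\mathbf h+\mathbf 1_i}$ to the $(\mathbf y_{\mathbf h+\mathbf 1_i},u_{\mathrm{In}(\mathbf h+\mathbf 1_i)})$-coordinates is not dominant. Then there exists $\mathbf h\in\mathbb Z_{\ge0}^m$ satisfying both (a) and (b). Moreover, every $\mathbf h=(h_1,\dots,h_m)\in\mathbb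 Z_{\ge0}^m$ satisfying (a) has $h_1+\dots+h_m\le s$. -/

import Mathlib

open MvPolynomial

/-! Algebraic differential models `x' = f(x, μ, u)`, `y = g(x, μ, u)`, `x(0) = x*` with `n` states,
`m` outputs, one scalar input and `l` system parameters, and their truncated prolongations. -/

namespace IdentModel

/-- The variables of `ℂ[x, μ, u]`. -/
inductive BaseVar (n l : ℕ) : Type
  | mu (i : Fin l)
  | x (i : Fin n)
  | u

/-- The variables of the differential polynomial ring `ℂ[μ]{x, y, u}`:
the constants `μ_i` and the derivatives `x_i^(j)`, `y_k^(j)`, `u^(j)`, `j ≥ 0`. -/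
inductive DiffVar (n m l : ℕ) : Type
  | mu (i : Fin l)
  | x (i : Fin n) (j : ℕ)
  | y (k : Fin m) (j : ℕ)
  | u (j : ℕ)

/-- `ℂ[x, μ, u]`. -/
abbrev BasePoly (n l : ℕ) : Type := MvPolynomial (BaseVar n l) ℂ

/-- `ℂ(x, μ, u)`. -/
abbrev BaseRat (n l : ℕ) : Type := FractionRing (BasePoly n l)

/-- The ring `R = ℂ[μ]{x, y, u}` of differential polynomials. -/
abbrev DiffPoly (n m l : ℕ) : Type := MvPolynomial (DiffVar n m l) ℂ

/-- The derivative of a variable of `ℂ[μ]{x, y, u}`; the `μ_i` are constants. -/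
noncomputable def DiffVar.deriv {n m l : ℕ} : DiffVar n m l → DiffPoly n m l
  | .mu _ => 0
  | .x i j => X (.x i (j + 1))
  | .y k j => X (.y k (j + 1))
  | .u j => X (.u (j + 1))

/-- The derivation of `ℂ[μ]{x, y, u}`. -/
noncomputable def diff (n m l : ℕ) : Derivation ℂ (DiffPoly n m l) (DiffPoly n m l) :=
  mkDerivation ℂ DiffVar.deriv

/-- The inclusion `ℂ[x, μ, u] ⊆ ℂ[μ]{x, y, u}` on variables. -/
def BaseVar.toDiff {n l : ℕ} (m : ℕ) : BaseVar n l → DiffVar n m l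
  | .mu i => .mu i
  | .x i => .x i 0
  | .u => .u 0

/-- The inclusion `ℂ[x, μ, u] ⊆ ℂ[μ]{x, y, u}`. -/
noncomputable def toDiff {n l : ℕ} (m : ℕ) (p : BasePoly n l) : DiffPoly n m l :=
  rename (BaseVar.toDiff m) p

/-- `ord_z P + 1`, where `z j` is the `j`-th derivative of a differential indeterminate `z`.
It is `0` if no derivative of `z` appears in `P` (the convention being `ord_z P = -1` then). -/
noncomputable def ordSucc {n m l : ℕ} (z : ℕ → DiffVar n m l) (P : DiffPoly n m l) : ℕ∞ :=
  ⨆ (j : ℕ) (_ : z j ∈ P.vars), ((j + 1 : ℕ) : ℕ∞)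

/-- The saturation `I : q^∞`. -/
def saturation {A : Type*} [CommRing A] (I : Ideal A) (q : A) : Ideal A where
  carrier := {r | ∃ N : ℕ, q ^ N * r ∈ I}
  zero_mem' := ⟨0, by simp⟩
  add_mem' := by
    rintro a b ⟨N, hN⟩ ⟨N', hN'⟩
    refine ⟨N + N', ?_⟩
    have h : q ^ (N + N') * (a + b) = q ^ N' * (q ^ N * a) + q ^ N * (q ^ N' * b) := by ring
    rw [h]
    exact I.add_mem (I.mul_mem_left _ hN) (I.mul_mem_left _ hN')
  smul_mem' := by
    rintro c a ⟨N, hN⟩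
    refine ⟨N, ?_⟩
    have h : q ^ N * (c • a) = c * (q ^ N * a) := by rw [smul_eq_mul]; ring
    rw [h]
    exact I.mul_mem_left _ hN

/-- Ideals generated, and saturated, in a polynomial ring on fewer variables may as well be
generated and saturated in the bigger ring, and then intersected with the smaller one. -/
theorem comap_saturation {σ : Type*} (s : Set σ) (T : Set (MvPolynomial s ℂ))
    (q : MvPolynomial s ℂ) :
    Ideal.comap (rename (Subtype.val : s → σ))
        (saturation (Ideal.span (rename Subtype.val '' T)) (rename Subtype.val q)) =
      saturation (Ideal.span T) q := by
  have hinj : Function.Injective (Subtype.val : s → σ) := Subtype.val_injective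
  have key : ∀ p : MvPolynomial s ℂ,
      rename (Subtype.val : s → σ) p ∈ Ideal.span (rename Subtype.val '' T) ↔
        p ∈ Ideal.span T := by
    intro p
    constructor
    · intro hp
      have h2 := Ideal.mem_map_of_mem (killCompl (R := ℂ) hinj) hp
      rw [Ideal.map_span, Set.image_image] at h2
      simpa only [killCompl_rename_app, Set.image_id'] using h2
    · intro hp
      have h2 := Ideal.mem_map_of_mem (rename (R := ℂ) (Subtype.val : s → σ)) hp
      rwa [Ideal.map_span] at h2
  ext r
  constructor
  · rintro ⟨N, hN⟩
    exact ⟨N, (key _).1 (by rw [map_mul, map_pow]; exact hN)⟩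
  · rintro ⟨N, hN⟩
    refine ⟨N, ?_⟩
    have := (key _).2 hN
    rwa [map_mul, map_pow] at this

/-- A subset of an affine space over `ℂ` is dense if its Zariski closure is everything. -/
def IsZariskiDense {σ : Type*} (V : Set (σ → ℂ)) : Prop :=
  zeroLocus ℂ (vanishingIdeal ℂ V) = Set.univ

/-- An algebraic differential model, given by the right-hand sides `f` and `g`. The initial states
`x*` are `n` further free parameters, so that the model has `l + n` parameters `(μ, x*)`. -/
structure Model (n m l : ℕ) where
  f : Fin n → BaseRat n l
  g : Fin m → BaseRat n l

namespace Model

variable {n m l : ℕ} (M : Model n m l)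

/-- The right-hand sides `f_1, …, f_n, g_1, …, g_m`. -/
def rhs : Fin n ⊕ Fin m → BaseRat n l := Sum.elim M.f M.g

/-- `Q`: the lcm of the denominators (in lowest terms) of all `f_i` and `g_k`. -/
noncomputable def Q : BasePoly n l :=
  letI : NormalizedGCDMonoid (BasePoly n l) := Classical.arbitrary _
  Finset.univ.lcm fun i => (IsFractionRing.den (BasePoly n l) (M.rhs i) : BasePoly n l)

theorem exists_numerator (i : Fin n ⊕ Fin m) :
    ∃ p : BasePoly n l, algebraMap _ (BaseRat n l) p = algebraMap _ _ M.Q * M.rhs i := by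
  let _ : NormalizedGCDMonoid (BasePoly n l) := Classical.arbitrary _
  have h : (IsFractionRing.den (BasePoly n l) (M.rhs i) : BasePoly n l) ∣ M.Q :=
    Finset.dvd_lcm (f := fun i => (IsFractionRing.den (BasePoly n l) (M.rhs i) : BasePoly n l))
      (Finset.mem_univ i)
  obtain ⟨c, hc⟩ := h
  refine ⟨c * IsFractionRing.num (BasePoly n l) (M.rhs i), ?_⟩
  have hd : algebraMap (BasePoly n l) (BaseRat n l)
      (IsFractionRing.den (BasePoly n l) (M.rhs i)) ≠ 0 :=
    IsFractionRing.to_map_ne_zero_of_mem_nonZeroDivisors (SetLike.coe_mem _)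
  conv_rhs => rw [← IsFractionRing.mk'_num_den' (BasePoly n l) (M.rhs i)]
  rw [hc, map_mul, map_mul]
  field_simp

/-- `F_i = Q f_i` and `G_k = Q g_k`, as polynomials. -/
noncomputable def numerator (i : Fin n ⊕ Fin m) : BasePoly n l := (M.exists_numerator i).choose

theorem numerator_spec (i : Fin n ⊕ Fin m) :
    algebraMap _ (BaseRat n l) (M.numerator i) = algebraMap _ _ M.Q * M.rhs i :=
  (M.exists_numerator i).choose_spec

/-- `Q` as a differential polynomial. -/
noncomputable def diffQ : DiffPoly n m l := toDiff m M.Q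

/-- `Q x_i' - F_i`. -/
noncomputable def stateEq (i : Fin n) : DiffPoly n m l :=
  M.diffQ * X (.x i 1) - toDiff m (M.numerator (.inl i))

/-- `Q y_k - G_k`. -/
noncomputable def outputEq (k : Fin m) : DiffPoly n m l :=
  M.diffQ * X (.y k 0) - toDiff m (M.numerator (.inr k))

/-- The set `S_h`: it contains `(Q y_k - G_k)^(j)` for `0 ≤ j < h_k`, and, as soon as `x_i^(j+1)`
appears in one of its elements, also `(Q x_i' - F_i)^(j)`; it is the smallest such set. -/
inductive S (h : Fin m → ℕ) : DiffPoly n m l → Prop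
  | output (k : Fin m) (j : ℕ) (hj : j < h k) : S h ((diff n m l)^[j] (M.outputEq k))
  | state (i : Fin n) (j : ℕ) (P : DiffPoly n m l) (hP : S h P)
      (hx : DiffVar.x i (j + 1) ∈ P.vars) : S h ((diff n m l)^[j] (M.stateEq i))

/-- `State(h)_i = max {ord_{x_i} P | P ∈ S_h} + 1`. -/
noncomputable def stateOrd (h : Fin m → ℕ) (i : Fin n) : ℕ∞ :=
  ⨆ (P : DiffPoly n m l) (_ : M.S h P), ordSucc (DiffVar.x i) P

/-- `In(h) = max {ord_u P | P ∈ S_h} + 1`. -/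
noncomputable def inOrd (h : Fin m → ℕ) : ℕ∞ :=
  ⨆ (P : DiffPoly n m l) (_ : M.S h P), ordSucc DiffVar.u P

/-- The variables `μ, x_{State(h)}, y_h, u_{In(h)}` of the polynomial ring `R_h`. -/
def ringVars (h : Fin m → ℕ) : Set (DiffVar n m l) := {v | match v with
  | .mu _ => True
  | .x i j => (j : ℕ∞) < M.stateOrd h i
  | .y k j => j < h k
  | .u j => (j : ℕ∞) < M.inOrd h}

/-- The variables `y_h, u_{In(h)}`. -/
def ioVars (h : Fin m → ℕ) : Set (DiffVar n m l) := {v | match v with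
  | .mu _ => False
  | .x _ _ => False
  | .y k j => j < h k
  | .u j => (j : ℕ∞) < M.inOrd h}

theorem ioVars_subset (h : Fin m → ℕ) : M.ioVars h ⊆ M.ringVars h := by
  intro v hv
  cases v with
  | mu i => exact hv.elim
  | x i j => exact hv.elim
  | y k j => exact hv
  | u j => exact hv

/-- The polynomial ring `R_h = ℂ[μ, x_{State(h)}, y_h, u_{In(h)}]`. -/
abbrev ring (h : Fin m → ℕ) : Type := MvPolynomial (M.ringVars h) ℂ

/-- The ideal `J_h = (S_h) : Q^∞` of `R_h`. The products `Q^N r`, `r ∈ R_h`, are formed in the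
ring of all differential polynomials, because `Q` need not lie in `R_h` when `S_h` is empty;
see `comap_saturation`. -/
noncomputable def J (h : Fin m → ℕ) : Ideal (M.ring h) :=
  Ideal.comap (rename Subtype.val) (saturation (Ideal.span {P | M.S h P}) M.diffQ)

/-- `Z_h`: the zero set of `J_h` in the affine space with coordinates `ringVars h`. -/
def Z (h : Fin m → ℕ) : Set (M.ringVars h → ℂ) := zeroLocus ℂ (M.J h)

/-- The projection to the `(y_h, u_{In(h)})`-coordinates. -/
def outProj (h : Fin m → ℕ) (p : M.ringVars h → ℂ) : M.ioVars h → ℂ :=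
  fun v => p ⟨v, M.ioVars_subset h v.2⟩

/-- The projection of `Z_h` to the `(y_h, u_{In(h)})`-coordinates is dominant. -/
def ProjectionDominant (h : Fin m → ℕ) : Prop := IsZariskiDense (M.outProj h '' M.Z h)

/-- Requirement (a). -/
def RequirementA (h : Fin m → ℕ) : Prop := M.ProjectionDominant h

/-- Requirement (b). -/
def RequirementB (h : Fin m → ℕ) : Prop := ∀ i : Fin m, ¬ M.ProjectionDominant (h + Pi.single i 1)

end Model

end IdentModel

/-!
Let `W = (ℂ[μ]{x, y, u} / (S_h))_Q`; a differential polynomial maps to zero in `W` exactly if it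
lies in `(S_h) : Q^∞`. Two observations about `W` bound the sum of `h`.

* If the projection is dominant, then the `y_h` and `u_{In(h)}` are algebraically independent in
  `W`: a relation among them belongs to `J_h`, so it vanishes on the dense image of `Z_h`
  (`ProjectionDominant.algebraicIndependent`).
* The elements of `S_h` are `Q z^(j)` plus lower terms (`exists_iterate_diff_eq`), where `z` is an
  output or the derivative of a state, and every `x_i^(j)` with `j ≥ 1` in `R_h` is the leading
  derivative of one of them (`S_stateEq_of_lt`). As `Q` is invertible in `W`, all variables of
  `R_h` are in `W` polynomials in `μ`, `x`, `u_{In(h)}` and `1/Q` (`toLocalizedQuotient_X_mem`).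

So the `y_h` and `u_{In(h)}` lift to algebraically independent elements of the localization
`ℂ[μ, x, u_{In(h)}]_Q`, a domain of transcendence degree `l + n + In(h)`, and counting gives
`h_1 + ⋯ + h_m ≤ l + n`. Neither primality of `J_h` nor the Nullstellensatz is needed.

Since `h = 0` satisfies (a), there is an `h` with (a) of maximal sum, and it satisfies (b).
-/

/-! ### Derivations and algebraic independence -/

theorem Derivation.mem_of_mem_adjoin {R A : Type*} [CommRing R] [CommRing A] [Algebra R A]
    (D : Derivation R A A) {s : Set A} {B : Subalgebra R A} (hs : s ⊆ B)
    (hD : ∀ a ∈ s, D a ∈ B) {a : A} (ha : a ∈ Algebra.adjoin R s) : D a ∈ B := by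
  have hB : Algebra.adjoin R s ≤ B := Algebra.adjoin_le hs
  induction ha using Algebra.adjoin_induction with
  | mem a ha => exact hD a ha
  | algebraMap r => simp
  | add a b _ _ iha ihb => rw [map_add]; exact B.add_mem iha ihb
  | mul a b ha hb iha ihb =>
    rw [D.leibniz, smul_eq_mul, smul_eq_mul]
    exact B.add_mem (B.mul_mem (hB ha) ihb) (B.mul_mem (hB hb) iha)

theorem MvPolynomial.vars_pderiv_subset {σ R : Type*} [CommRing R] (i : σ)
    (p : MvPolynomial σ R) : (pderiv i p).vars ⊆ p.vars := by
  classical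
  have h : pderiv i p ∈ supported R (p.vars : Set σ) := by
    refine (pderiv i).mem_of_mem_adjoin (s := X '' (p.vars : Set σ)) Algebra.subset_adjoin ?_
      (mem_supported_vars p)
    rintro _ ⟨v, -, rfl⟩
    rw [pderiv_X, Pi.single_apply]
    split_ifs
    · exact one_mem _
    · exact zero_mem _
  exact_mod_cast mem_supported.1 h

/-- The homomorphism `ℂ[Z]_q → W` sending the variables to the family `z`, where `q(z)` is
invertible in `W`. -/
noncomputable def fractionsHom {W κ : Type*} [CommRing W] [Algebra ℂ W] (z : κ → W)
    (q : MvPolynomial κ ℂ) (hq : IsUnit (aeval z q)) : Localization.Away q →ₐ[ℂ] W :=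
  IsLocalization.liftAlgHom (M := Submonoid.powers q) (f := aeval z) (by
    rintro ⟨_, N, rfl⟩
    simpa using hq.pow N)

theorem fractionsHom_algebraMap {W κ : Type*} [CommRing W] [Algebra ℂ W] {z : κ → W}
    {q : MvPolynomial κ ℂ} (hq : IsUnit (aeval z q)) (p : MvPolynomial κ ℂ) :
    fractionsHom z q hq (algebraMap _ _ p) = aeval z p := by
  simp [fractionsHom]

theorem mem_range_fractionsHom_of_mul_mem {W κ : Type*} [CommRing W] [Algebra ℂ W] {z : κ → W}
    {q : MvPolynomial κ ℂ} (hq : IsUnit (aeval z q)) {w : W}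
    (hw : aeval z q * w ∈ (fractionsHom z q hq).range) : w ∈ (fractionsHom z q hq).range := by
  obtain ⟨b, hb⟩ := hw
  replace hb : fractionsHom z q hq b = aeval z q * w := hb
  refine ⟨b * IsLocalization.Away.invSelf q, hq.mul_left_cancel ?_⟩
  have h := congrArg (fractionsHom z q hq)
    (IsLocalization.Away.mul_invSelf (S := Localization.Away q) q)
  rw [map_mul, map_one, fractionsHom_algebraMap] at h
  change _ * fractionsHom z q hq _ = _
  rw [← hb, map_mul, mul_left_comm, h, mul_one]

/-- An algebraically independent family in the image of `ℂ[Z]_q` has at most as many members as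
there are variables `Z`, even if the target ring has zero divisors: a lift of the family to the
domain `ℂ[Z]_q` is again algebraically independent. -/
theorem card_le_of_algebraicIndependent_mem_range {W κ ι : Type} [CommRing W] [Algebra ℂ W]
    [Fintype κ] [Fintype ι] {z : κ → W} {q : MvPolynomial κ ℂ} (hq : IsUnit (aeval z q))
    (hq0 : q ≠ 0) {w : ι → W} (hw : AlgebraicIndependent ℂ w)
    (hmem : ∀ i, w i ∈ (fractionsHom z q hq).range) : Fintype.card ι ≤ Fintype.card κ := by
  choose b hb using hmem
  have hb' : AlgebraicIndependent ℂ b := by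
    refine AlgebraicIndependent.of_comp (fractionsHom z q hq) ?_
    convert hw
    exact funext hb
  have hle : Submonoid.powers q ≤ nonZeroDivisors (MvPolynomial κ ℂ) :=
    powers_le_nonZeroDivisors_of_noZeroDivisors hq0
  have : IsDomain (Localization.Away q) := IsLocalization.isDomain_localization hle
  have : FaithfulSMul (MvPolynomial κ ℂ) (Localization.Away q) :=
    (faithfulSMul_iff_algebraMap_injective _ _).2 (IsLocalization.injective _ hle)
  have : Algebra.IsAlgebraic (MvPolynomial κ ℂ) (Localization.Away q) :=
    IsLocalization.isAlgebraic _ (Submonoid.powers q)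
  have h1 := hb'.cardinalMk_le_trdeg
  have h2 := trdeg_add_eq ℂ (MvPolynomial κ ℂ) (A := Localization.Away q)
  rw [trdeg_eq_zero (R := MvPolynomial κ ℂ), add_zero, MvPolynomial.trdeg_of_isDomain] at h2
  rw [← h2] at h1
  simpa using h1

/-! ### Leading terms of prolonged equations -/

namespace IdentModel

variable {n m l : ℕ}

/-- The `μ_i`, and the derivatives of the states and of the input up to order `j`. -/
def DiffVar.upTo (n m l j : ℕ) : Set (DiffVar n m l) := {v | match v with
  | .mu _ => True
  | .x _ a => a ≤ j
  | .y _ _ => False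
  | .u a => a ≤ j}

theorem DiffVar.upTo_mono {j j' : ℕ} (hj : j ≤ j') :
    DiffVar.upTo n m l j ⊆ DiffVar.upTo n m l j' := by
  intro v hv
  cases v <;> simp only [DiffVar.upTo, Set.mem_ofPred_eq] at hv ⊢ <;> omega

theorem diff_X (v : DiffVar n m l) : diff n m l (X v) = v.deriv := mkDerivation_X ..

theorem diff_mem_supported {T T' : Set (DiffVar n m l)} (hT : T ⊆ T')
    (hd : ∀ v ∈ T, v.deriv ∈ supported ℂ T') {p : DiffPoly n m l} (hp : p ∈ supported ℂ T) :
    diff n m l p ∈ supported ℂ T' := by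
  refine (diff n m l).mem_of_mem_adjoin (s := X '' T) ?_ ?_ hp
  · rintro _ ⟨v, hv, rfl⟩
    exact X_mem_supported.2 (hT hv)
  · rintro _ ⟨v, hv, rfl⟩
    rw [diff_X]
    exact hd v hv

theorem deriv_mem_supported_upTo {j : ℕ} {v : DiffVar n m l} (hv : v ∈ DiffVar.upTo n m l j) :
    v.deriv ∈ supported ℂ (DiffVar.upTo n m l (j + 1)) := by
  cases v <;> simp_all [DiffVar.upTo, DiffVar.deriv]

/-- Differentiation raises the order in `x_i` by at most one. -/
theorem x_mem_vars_of_mem_vars_diff {p : DiffPoly n m l} {i : Fin n} {j : ℕ}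
    (h : DiffVar.x i (j + 1) ∈ (diff n m l p).vars) :
    DiffVar.x i (j + 1) ∈ p.vars ∨ DiffVar.x i j ∈ p.vars := by
  by_contra! hcon
  have hs : diff n m l p ∈ supported ℂ {DiffVar.x i (j + 1)}ᶜ := by
    have hp : p ∈ supported ℂ (p.vars : Set (DiffVar n m l)) := mem_supported_vars p
    refine diff_mem_supported ?_ ?_ hp
    · rintro v hv rfl
      exact hcon.1 hv
    · intro v hv
      cases v <;> simp only [DiffVar.deriv, zero_mem, X_mem_supported, Set.mem_compl_iff,
        Set.mem_singleton_iff, reduceCtorEq, not_false_eq_true]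
      rintro ⟨rfl, rfl⟩
      exact hcon.2 hv
  exact mem_supported.1 hs h rfl

/-- If `x_i^(j+1)` occurs in the `p`-th derivative of an `E` of order at most one in `x_i`, then
each lower `x_i^(j'+1)` occurs in a derivative of `E` of order at most `p`. -/
theorem exists_x_mem_vars_iterate_diff {E : DiffPoly n m l} {i : Fin n}
    (hE : ∀ b, DiffVar.x i b ∈ E.vars → b ≤ 1) {p j j' : ℕ} (hj : j' ≤ j)
    (h : DiffVar.x i (j + 1) ∈ ((diff n m l)^[p] E).vars) :
    ∃ q ≤ p, DiffVar.x i (j' + 1) ∈ ((diff n m l)^[q] E).vars := by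
  induction p generalizing j with
  | zero =>
    have := hE _ h
    obtain rfl : j = j' := by omega
    exact ⟨0, le_rfl, h⟩
  | succ p ih =>
    have h' := h
    rw [Function.iterate_succ_apply'] at h'
    rcases hj.eq_or_lt with rfl | hlt
    · exact ⟨p + 1, le_rfl, h⟩
    obtain ⟨k, rfl⟩ : ∃ k, j = k + 1 := ⟨j - 1, by omega⟩
    have key : ∃ q ≤ p, DiffVar.x i (j' + 1) ∈ ((diff n m l)^[q] E).vars := by
      rcases x_mem_vars_of_mem_vars_diff h' with h1 | h1
      · exact ih hj h1
      · exact ih (by omega) h1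
    obtain ⟨q, hq, hq'⟩ := key
    exact ⟨q, by omega, hq'⟩

/-- The `j`-th derivative of `Q z - F` is `Q z^(j)` plus terms in lower derivatives of `z` and in
derivatives up to order `j` of states and input. -/
theorem exists_iterate_diff_eq {q F : DiffPoly n m l}
    (hq : q ∈ supported ℂ (DiffVar.upTo n m l 0)) (hF : F ∈ supported ℂ (DiffVar.upTo n m l 0))
    {z : ℕ → DiffVar n m l} (hz : ∀ j, (z j).deriv = X (z (j + 1))) (j : ℕ) :
    ∃ r ∈ supported ℂ (DiffVar.upTo n m l j ∪ z '' Set.Iio j),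
      (diff n m l)^[j] (q * X (z 0) - F) = q * X (z j) + r := by
  induction j with
  | zero => exact ⟨-F, by simpa using hF, by simp [sub_eq_add_neg]⟩
  | succ j ih =>
    obtain ⟨r, hr, he⟩ := ih
    refine ⟨diff n m l q * X (z j) + diff n m l r, add_mem (mul_mem ?_ ?_) ?_, ?_⟩
    · refine supported_mono ((DiffVar.upTo_mono (by omega : 1 ≤ j + 1)).trans
        Set.subset_union_left) ?_
      exact diff_mem_supported (DiffVar.upTo_mono zero_le_one)
        (fun v hv => deriv_mem_supported_upTo hv) hq
    · exact X_mem_supported.2 (Or.inr ⟨j, Nat.lt_succ_self j, rfl⟩)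
    · refine diff_mem_supported ?_ ?_ hr
      · exact Set.union_subset_union (DiffVar.upTo_mono j.le_succ)
          (Set.image_mono (Set.Iio_subset_Iio j.le_succ))
      · rintro v (hv | ⟨a, ha, rfl⟩)
        · exact supported_mono Set.subset_union_left (deriv_mem_supported_upTo hv)
        · rw [hz]
          exact X_mem_supported.2 (Or.inr ⟨a + 1, Nat.succ_lt_succ ha, rfl⟩)
    · rw [Function.iterate_succ_apply', he, map_add, Derivation.leibniz, diff_X, hz]
      simp only [smul_eq_mul]
      ring

theorem toDiff_mem_supported (p : BasePoly n l) :
    toDiff m p ∈ supported ℂ (DiffVar.upTo n m l 0) := by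
  classical
  rw [mem_supported]
  intro v hv
  obtain ⟨w, -, rfl⟩ := mem_vars_rename _ _ hv
  cases w <;> simp [BaseVar.toDiff, DiffVar.upTo]

namespace Model

variable (M : Model n m l) {h : Fin m → ℕ}

theorem Q_ne_zero : M.Q ≠ 0 := by
  let _ : NormalizedGCDMonoid (BasePoly n l) := Classical.arbitrary _
  intro h
  obtain ⟨i, -, hi⟩ := Finset.lcm_eq_zero_iff.1 h
  exact nonZeroDivisors.ne_zero (SetLike.coe_mem _) hi

theorem diffQ_ne_zero : M.diffQ ≠ 0 := by
  intro h
  refine M.Q_ne_zero (rename_injective (BaseVar.toDiff m) ?_ (h.trans (map_zero _).symm))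
  intro a b hab
  cases a <;> cases b <;> simp_all [BaseVar.toDiff]

theorem exists_iterate_outputEq (k : Fin m) (j : ℕ) :
    ∃ r ∈ supported ℂ (DiffVar.upTo n m l j ∪ DiffVar.y k '' Set.Iio j),
      (diff n m l)^[j] (M.outputEq k) = M.diffQ * X (.y k j) + r :=
  exists_iterate_diff_eq (toDiff_mem_supported _) (toDiff_mem_supported _) (fun _ => rfl) j

theorem exists_iterate_stateEq (i : Fin n) (j : ℕ) :
    ∃ r ∈ supported ℂ (DiffVar.upTo n m l j),
      (diff n m l)^[j] (M.stateEq i) = M.diffQ * X (.x i (j + 1)) + r := by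
  obtain ⟨r, hr, he⟩ := exists_iterate_diff_eq (toDiff_mem_supported M.Q)
    (toDiff_mem_supported (M.numerator (.inl i))) (z := fun a => DiffVar.x i (a + 1))
    (fun _ => rfl) j
  refine ⟨r, ?_, he⟩
  rwa [Set.union_eq_left.2] at hr
  rintro _ ⟨a, ha, rfl⟩
  exact Nat.succ_le_of_lt ha

theorem outputEq_mem_supported (k : Fin m) (j : ℕ) :
    (diff n m l)^[j] (M.outputEq k) ∈
      supported ℂ (DiffVar.upTo n m l j ∪ DiffVar.y k '' Set.Iic j) := by
  obtain ⟨r, hr, he⟩ := M.exists_iterate_outputEq k j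
  rw [he]
  refine add_mem (mul_mem ?_ (X_mem_supported.2 (Or.inr ⟨j, Set.self_mem_Iic, rfl⟩))) ?_
  · exact supported_mono ((DiffVar.upTo_mono j.zero_le).trans Set.subset_union_left)
      (toDiff_mem_supported _)
  · exact supported_mono (Set.union_subset_union le_rfl (Set.image_mono Set.Iio_subset_Iic_self)) hr

theorem stateEq_mem_supported (i : Fin n) (j : ℕ) :
    (diff n m l)^[j] (M.stateEq i) ∈ supported ℂ (DiffVar.upTo n m l (j + 1)) := by
  obtain ⟨r, hr, he⟩ := M.exists_iterate_stateEq i j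
  rw [he]
  refine add_mem (mul_mem ?_ (X_mem_supported.2 (le_refl (j + 1)))) ?_
  · exact supported_mono (DiffVar.upTo_mono (Nat.zero_le _)) (toDiff_mem_supported _)
  · exact supported_mono (DiffVar.upTo_mono j.le_succ) hr

variable {M}

/-! ### The structure of `S_h` -/

/-- `S_h` is closed under passing from a prolongation of an equation to its lower derivatives. -/
theorem S.exists_lower {P : DiffPoly n m l} (hP : M.S h P) :
    ∃ (E : DiffPoly n m l) (p : ℕ), P = (diff n m l)^[p] E ∧
      (∀ q ≤ p, M.S h ((diff n m l)^[q] E)) ∧ ∀ i b, DiffVar.x i b ∈ E.vars → b ≤ 1 := by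
  induction hP with
  | output k j hj =>
    refine ⟨_, j, rfl, fun q hq => S.output k q (by omega), fun i b hb => ?_⟩
    rcases mem_supported.1 (M.outputEq_mem_supported k 0) hb with h | ⟨_, _, h⟩
    · exact le_trans h zero_le_one
    · cases h
  | state i j P hP hx ih =>
    obtain ⟨E, p, rfl, hE, hord⟩ := ih
    refine ⟨_, j, rfl, fun q hq => ?_, fun i' b hb => ?_⟩
    · obtain ⟨p', hp', hx'⟩ := exists_x_mem_vars_iterate_diff (hord i) hq hx
      exact S.state i q _ (hE p' hp') hx'
    · exact mem_supported.1 (M.stateEq_mem_supported i 0) hb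

theorem x_lt_stateOrd {P : DiffPoly n m l} (hP : M.S h P) {i : Fin n} {j : ℕ}
    (hx : DiffVar.x i j ∈ P.vars) : (j : ℕ∞) < M.stateOrd h i := by
  refine lt_of_lt_of_le (b := ((j + 1 : ℕ) : ℕ∞)) (by exact_mod_cast j.lt_succ_self) ?_
  exact le_iSup₂_of_le P hP (le_iSup₂_of_le (f := fun j (_ : DiffVar.x i j ∈ P.vars) =>
    ((j + 1 : ℕ) : ℕ∞)) j hx le_rfl)

theorem u_lt_inOrd {P : DiffPoly n m l} (hP : M.S h P) {j : ℕ}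
    (hu : DiffVar.u j ∈ P.vars) : (j : ℕ∞) < M.inOrd h := by
  refine lt_of_lt_of_le (b := ((j + 1 : ℕ) : ℕ∞)) (by exact_mod_cast j.lt_succ_self) ?_
  exact le_iSup₂_of_le P hP (le_iSup₂_of_le (f := fun j (_ : DiffVar.u j ∈ P.vars) =>
    ((j + 1 : ℕ) : ℕ∞)) j hu le_rfl)

/-- For every positive order of `x_i` occurring in `R_h`, the equation with that derivative as its
leading term belongs to `S_h`. -/
theorem S_stateEq_of_lt {i : Fin n} {j : ℕ} (hj : ((j + 1 : ℕ) : ℕ∞) < M.stateOrd h i) :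
    M.S h ((diff n m l)^[j] (M.stateEq i)) := by
  simp only [stateOrd, ordSucc, lt_iSup_iff] at hj
  obtain ⟨P, hP, a, ha, hlt⟩ := hj
  have hlt' : j + 1 < a + 1 := by exact_mod_cast hlt
  obtain ⟨a, rfl⟩ : ∃ b, a = b + 1 := ⟨a - 1, by omega⟩
  obtain ⟨E, p, rfl, hE, hord⟩ := hP.exists_lower
  obtain ⟨q, hq, hx⟩ := exists_x_mem_vars_iterate_diff (hord i) (by omega : j ≤ a) ha
  exact S.state i j _ (hE q hq) hx

/-- The orders of the states and the input in `S_h` are bounded by `h_1 + ⋯ + h_m`. -/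
theorem S.order_le {P : DiffPoly n m l} (hP : M.S h P) :
    P ∈ supported ℂ (DiffVar.upTo n m l (∑ k, h k) ∪
      {v | ∃ k j, v = DiffVar.y k j ∧ j < h k}) := by
  induction hP with
  | output k j hj =>
    refine supported_mono (Set.union_subset_union (DiffVar.upTo_mono ?_) ?_)
      (M.outputEq_mem_supported k j)
    · exact hj.le.trans (Finset.single_le_sum (fun _ _ => Nat.zero_le _) (Finset.mem_univ k))
    · rintro _ ⟨a, ha, rfl⟩
      exact ⟨k, a, rfl, lt_of_le_of_lt ha hj⟩
  | state i j P hP hx ih =>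
    rcases mem_supported.1 ih hx with hj | ⟨_, _, hy, _⟩
    · exact supported_mono ((DiffVar.upTo_mono hj).trans Set.subset_union_left)
        (M.stateEq_mem_supported i j)
    · cases hy

theorem inOrd_ne_top : M.inOrd h ≠ ⊤ := by
  refine ne_top_of_le_ne_top (ENat.natCast_ne_top (∑ k, h k + 1)) ?_
  refine iSup₂_le fun P hP => iSup₂_le fun j hj => ?_
  rcases mem_supported.1 hP.order_le hj with hj | ⟨_, _, hy, _⟩
  · exact_mod_cast Nat.succ_le_succ hj
  · cases hy

/-- The variables of the elements of `S_h` are those of `R_h`. -/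
theorem S.vars_subset {P : DiffPoly n m l} (hP : M.S h P) : (P.vars : Set _) ⊆ M.ringVars h := by
  intro v hv
  have hs := mem_supported.1 hP.order_le hv
  cases v with
  | mu i => trivial
  | x i j => exact x_lt_stateOrd hP hv
  | u j => exact u_lt_inOrd hP hv
  | y k j =>
    rcases hs with hs | ⟨k', j', hy, hlt⟩
    · exact hs.elim
    · cases hy
      exact hlt

/-- `Q` is the partial derivative of `Q y_k - G_k` by `y_k`. -/
theorem vars_diffQ_subset_vars_outputEq (k : Fin m) : M.diffQ.vars ⊆ (M.outputEq k).vars := by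
  have hy : ∀ p : BasePoly n l, pderiv (DiffVar.y k 0) (toDiff m p) = 0 := fun p =>
    pderiv_eq_zero_of_notMem_vars fun hv => mem_supported.1 (toDiff_mem_supported p) hv
  have hQ : pderiv (DiffVar.y k 0) (M.outputEq k) = M.diffQ := by
    rw [outputEq, map_sub, hy, Derivation.leibniz, diffQ, hy, pderiv_X_self]
    simp
  rw [← hQ]
  exact vars_pderiv_subset _ _

/-- `Q` lies in `R_h` unless `S_h` is empty: its variables occur in each `Q y_k - G_k`. -/
theorem diffQ_mem_supported (hh : h ≠ 0) : M.diffQ ∈ supported ℂ (M.ringVars h) := by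
  obtain ⟨k, hk⟩ := Function.ne_iff.1 hh
  refine mem_supported.2 (Set.Subset.trans ?_
    (S.output (M := M) k 0 (Nat.pos_of_ne_zero hk)).vars_subset)
  exact_mod_cast vars_diffQ_subset_vars_outputEq k

/-! ### The localized quotient and the bound on `h` -/

variable (M h)

/-- The ring `(ℂ[μ]{x, y, u} / (S_h))_Q`. -/
abbrev LocalizedQuotient : Type :=
  Localization.Away (Ideal.Quotient.mk (Ideal.span {P | M.S h P}) M.diffQ)

/-- The canonical homomorphism to `(ℂ[μ]{x, y, u} / (S_h))_Q`; its kernel is `(S_h) : Q^∞`. -/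
noncomputable def toLocalizedQuotient : DiffPoly n m l →ₐ[ℂ] M.LocalizedQuotient h :=
  (Algebra.algHom ℂ (DiffPoly n m l ⧸ Ideal.span {P | M.S h P}) (M.LocalizedQuotient h)).comp
    (Ideal.Quotient.mkₐ ℂ _)

variable {M h}

theorem mem_saturation_of_toLocalizedQuotient_eq_zero {p : DiffPoly n m l}
    (hp : M.toLocalizedQuotient h p = 0) :
    p ∈ saturation (Ideal.span {P | M.S h P}) M.diffQ := by
  obtain ⟨⟨_, N, rfl⟩, hN⟩ := (IsLocalization.map_eq_zero_iff
    (Submonoid.powers (Ideal.Quotient.mk (Ideal.span {P | M.S h P}) M.diffQ))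
    (M.LocalizedQuotient h) (Ideal.Quotient.mk _ p)).1 hp
  refine ⟨N, Ideal.Quotient.eq_zero_iff_mem.1 ?_⟩
  rw [map_mul, map_pow]
  exact hN

theorem toLocalizedQuotient_eq_zero {P : DiffPoly n m l} (hP : M.S h P) :
    M.toLocalizedQuotient h P = 0 := by
  have h0 : Ideal.Quotient.mk (Ideal.span {P | M.S h P}) P = 0 :=
    Ideal.Quotient.eq_zero_iff_mem.2 (Ideal.subset_span (show P ∈ {P | M.S h P} from hP))
  change algebraMap _ (M.LocalizedQuotient h) (Ideal.Quotient.mk (Ideal.span {P | M.S h P}) P) = 0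
  rw [h0, map_zero]

theorem isUnit_toLocalizedQuotient_diffQ : IsUnit (M.toLocalizedQuotient h M.diffQ) :=
  IsLocalization.Away.algebraMap_isUnit
    (Ideal.Quotient.mk (Ideal.span {P | M.S h P}) M.diffQ)

/-- A polynomial relation between the `y_h, u_{In(h)}` modulo `(S_h) : Q^∞` would vanish on the
projection of `Z_h`. -/
theorem ProjectionDominant.algebraicIndependent (hd : M.ProjectionDominant h) :
    AlgebraicIndependent ℂ
      fun v : M.ioVars h => M.toLocalizedQuotient h (X (v : DiffVar n m l)) := by
  rw [algebraicIndependent_iff]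
  intro p hp
  have hren : M.toLocalizedQuotient h (rename Subtype.val p) = 0 := by
    rw [← hp, ← AlgHom.comp_apply]
    congr 1
    ext v
    simp
  have hJ : rename (Set.inclusion (M.ioVars_subset h)) p ∈ M.J h := by
    refine Ideal.mem_comap.2 ?_
    rw [rename_rename]
    exact mem_saturation_of_toLocalizedQuotient_eq_zero hren
  have hv : p ∈ vanishingIdeal ℂ (M.outProj h '' M.Z h) := by
    rintro _ ⟨a, ha, rfl⟩
    have := ha _ hJ
    rwa [aeval_rename] at this
  refine MvPolynomial.funext fun a => ?_
  have ha : a ∈ zeroLocus ℂ (vanishingIdeal ℂ (M.outProj h '' M.Z h)) := by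
    rw [show zeroLocus ℂ _ = Set.univ from hd]
    trivial
  simpa [aeval_eq_eval] using ha p hv

/-- A subalgebra in which `Q` can be cancelled contains the images of all variables of `R_h`, as
soon as it contains those of the `μ_i`, `x_i` and `u_{In(h)}`: the system `S_h` is triangular,
with all leading coefficients equal to `Q`. -/
theorem toLocalizedQuotient_X_mem (hh : h ≠ 0) (A : Subalgebra ℂ (M.LocalizedQuotient h))
    (hmu : ∀ i, M.toLocalizedQuotient h (X (.mu i)) ∈ A)
    (hx : ∀ i, M.toLocalizedQuotient h (X (.x i 0)) ∈ A)
    (hu : ∀ j : ℕ, (j : ℕ∞) < M.inOrd h → M.toLocalizedQuotient h (X (.u j)) ∈ A)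
    (hQ : ∀ w, M.toLocalizedQuotient h M.diffQ * w ∈ A → w ∈ A)
    {v : DiffVar n m l} (hv : v ∈ M.ringVars h) : M.toLocalizedQuotient h (X v) ∈ A := by
  have hsupp : ∀ (T : Set (DiffVar n m l)), (∀ v ∈ T, M.toLocalizedQuotient h (X v) ∈ A) →
      ∀ r ∈ supported ℂ T, M.toLocalizedQuotient h r ∈ A := by
    intro T hT r hr
    have hle : supported ℂ T ≤ A.comap (M.toLocalizedQuotient h) := by
      refine Algebra.adjoin_le ?_
      rintro _ ⟨v, hv, rfl⟩
      exact hT v hv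
    exact hle hr
  -- A variable `v` with an equation `Q v + r = 0` in `S_h` lies in `A` once those of `r` do.
  have hlead : ∀ (T : Set (DiffVar n m l)) (v : DiffVar n m l) (r : DiffPoly n m l),
      v ∈ M.ringVars h → M.S h (M.diffQ * X v + r) → r ∈ supported ℂ T →
      (∀ w ∈ T, w ∈ M.ringVars h → M.toLocalizedQuotient h (X w) ∈ A) →
      M.toLocalizedQuotient h (X v) ∈ A := by
    intro T v r hv hS hr hT
    have hr' : r ∈ supported ℂ (M.ringVars h) := by
      have h1 : M.diffQ * X v + r ∈ supported ℂ (M.ringVars h) := mem_supported.2 hS.vars_subset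
      have h2 := mul_mem (diffQ_mem_supported hh) (X_mem_supported (R := ℂ).2 hv)
      simpa using sub_mem h1 h2
    have hrA : M.toLocalizedQuotient h r ∈ A := by
      refine hsupp (T ∩ M.ringVars h) (fun w hw => hT w hw.1 hw.2) r (mem_supported.2 ?_)
      exact Set.subset_inter (mem_supported.1 hr) (mem_supported.1 hr')
    refine hQ _ ?_
    have h0 := toLocalizedQuotient_eq_zero hS
    rw [map_add, map_mul] at h0
    rw [eq_neg_of_add_eq_zero_left h0]
    exact neg_mem hrA
  have hstate : ∀ (j : ℕ) (i : Fin n), (j : ℕ∞) < M.stateOrd h i →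
      M.toLocalizedQuotient h (X (.x i j)) ∈ A := by
    intro j
    induction j using Nat.strong_induction_on with
    | _ j ih =>
      intro i hj
      rcases j with _ | j
      · exact hx i
      obtain ⟨r, hr, he⟩ := M.exists_iterate_stateEq i j
      refine hlead _ _ r hj (he ▸ S_stateEq_of_lt hj) hr fun w hw hw' => ?_
      cases w with
      | mu i => exact hmu i
      | x i a => exact ih a (Nat.lt_succ_of_le hw) i hw'
      | y k a => exact hw.elim
      | u a => exact hu a hw'
  have hout : ∀ (j : ℕ) (k : Fin m), j < h k → M.toLocalizedQuotient h (X (.y k j)) ∈ A := by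
    intro j
    induction j using Nat.strong_induction_on with
    | _ j ih =>
      intro k hj
      obtain ⟨r, hr, he⟩ := M.exists_iterate_outputEq k j
      refine hlead _ _ r hj (he ▸ S.output k j hj) hr fun w hw hw' => ?_
      cases w with
      | mu i => exact hmu i
      | x i a => exact hstate a i hw'
      | y k' a =>
        rcases hw with hw | ⟨_, ha, hw⟩
        · exact hw.elim
        · cases hw
          exact ih a ha k hw'
      | u a => exact hu a hw'
  cases v with
  | mu i => exact hmu i
  | x i j => exact hstate j i hv
  | y k j => exact hout j k hv
  | u j => exact hu j hv

/-- The `y_h` and `u_{In(h)}` are algebraically independent in the image of a localization of a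
polynomial ring in the `l + n + In(h)` variables `μ`, `x`, `u_{In(h)}`. -/
theorem RequirementA.sum_le (ha : M.RequirementA h) : ∑ i, h i ≤ l + n := by
  rcases eq_or_ne h 0 with rfl | hh
  · simp
  obtain ⟨N, hN⟩ := ENat.ne_top_iff_exists.1 (inOrd_ne_top (M := M) (h := h))
  let z : Fin l ⊕ Fin n ⊕ Fin N → DiffVar n m l :=
    Sum.elim DiffVar.mu (Sum.elim (fun i => DiffVar.x i 0) fun j => DiffVar.u j)
  have hz : Function.Injective z := by
    rintro (a | a | a) (b | b | b) hab <;> simp_all [z, Fin.ext_iff]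
  have hQz : (M.diffQ.vars : Set (DiffVar n m l)) ⊆ Set.range z := by
    intro v hv
    have h1 := mem_supported.1 (toDiff_mem_supported M.Q) hv
    have h2 := mem_supported.1 (diffQ_mem_supported hh) hv
    cases v with
    | mu i => exact ⟨.inl i, rfl⟩
    | x i j =>
      obtain rfl : j = 0 := Nat.le_zero.1 h1
      exact ⟨.inr (.inl i), rfl⟩
    | y k j => exact h1.elim
    | u j =>
      have h2' : (j : ℕ∞) < M.inOrd h := h2
      rw [← hN] at h2'
      exact ⟨.inr (.inr ⟨j, by exact_mod_cast h2'⟩), rfl⟩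
  obtain ⟨q, hq⟩ := exists_rename_eq_of_vars_subset_range M.diffQ z hz hQz
  have haev : ∀ p, aeval (fun i => M.toLocalizedQuotient h (X (z i))) p =
      M.toLocalizedQuotient h (rename z p) := by
    intro p
    rw [← AlgHom.comp_apply]
    congr 1
    ext v
    simp
  have hunit : IsUnit (aeval (fun i => M.toLocalizedQuotient h (X (z i))) q) := by
    rw [haev, hq]
    exact isUnit_toLocalizedQuotient_diffQ
  have hq0 : q ≠ 0 := by
    rintro rfl
    exact M.diffQ_ne_zero (by rw [← hq, map_zero])
  let y : (Σ k : Fin m, Fin (h k)) ⊕ Fin N → M.ioVars h :=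
    Sum.elim (fun k => ⟨.y k.1 k.2, k.2.2⟩)
      fun j => ⟨.u j, show ((j : ℕ) : ℕ∞) < M.inOrd h by rw [← hN]; exact_mod_cast j.2⟩
  have hy : Function.Injective y := by
    rintro (⟨a, a'⟩ | a) (⟨b, b'⟩ | b) hab <;> replace hab := congrArg Subtype.val hab <;>
      simp only [y, Sum.elim_inl, Sum.elim_inr, DiffVar.y.injEq, DiffVar.u.injEq,
        reduceCtorEq] at hab
    · obtain ⟨rfl, hab⟩ := hab
      rw [Fin.ext hab]
    · rw [Fin.ext hab]
  have hz_mem : ∀ i, M.toLocalizedQuotient h (X (z i)) ∈ (fractionsHom _ q hunit).range := by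
    intro i
    exact ⟨algebraMap _ _ (X i), (fractionsHom_algebraMap hunit _).trans (aeval_X _ _)⟩
  have hcard := card_le_of_algebraicIndependent_mem_range hunit hq0
    ((ProjectionDominant.algebraicIndependent ha).comp y hy) fun i =>
      toLocalizedQuotient_X_mem hh _ (fun i => hz_mem (.inl i)) (fun i => hz_mem (.inr (.inl i)))
        (fun j hj => hz_mem (.inr (.inr ⟨j, by rw [← hN] at hj; exact_mod_cast hj⟩)))
        (fun w hw => mem_range_fractionsHom_of_mul_mem hunit (by rwa [haev, hq]))
        (M.ioVars_subset h (y i).2)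
  simp only [Fintype.card_sum, Fintype.card_sigma, Fintype.card_fin] at hcard
  omega

/-- The polynomial ring `ℂ[y_h, u_{In(h)}]` has no variables for `h = 0`. -/
theorem requirementA_zero : M.RequirementA 0 := by
  have hS : ∀ P, ¬ M.S 0 P := by
    intro P hP
    induction hP with
    | output k j hj => exact Nat.not_lt_zero _ hj
    | state i j P hP hx ih => exact ih
  have hio : IsEmpty (M.ioVars 0) := by
    refine ⟨fun ⟨v, hv⟩ => ?_⟩
    cases v with
    | mu i => exact hv
    | x i j => exact hv
    | y k j => exact Nat.not_lt_zero _ hv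
    | u j => simp [ioVars, inOrd, hS] at hv
  have hZ : (0 : M.ringVars 0 → ℂ) ∈ M.Z 0 := by
    rintro p ⟨N, hN⟩
    have hspan : Ideal.span {P | M.S 0 P} = ⊥ := by simp [hS]
    rw [hspan, Ideal.mem_bot, mul_eq_zero] at hN
    have hp : rename Subtype.val p = 0 := hN.resolve_left (pow_ne_zero _ M.diffQ_ne_zero)
    rw [rename_injective _ Subtype.val_injective (hp.trans (map_zero _).symm), map_zero]
  refine Set.eq_univ_of_forall fun a p hp => hp a ⟨0, hZ, Subsingleton.elim _ _⟩

end Model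
end IdentModel

theorem mainTheorem7 {n m l : ℕ} (M : IdentModel.Model n m l) :
    (∃ h : Fin m → ℕ, M.RequirementA h ∧ M.RequirementB h) ∧
      ∀ h : Fin m → ℕ, M.RequirementA h → ∑ i, h i ≤ l + n := by
  refine ⟨?_, fun h ha => ha.sum_le⟩
  -- An `h` satisfying (a) whose sum is maximal satisfies (b).
  have hfin : {s | ∃ h : Fin m → ℕ, M.RequirementA h ∧ ∑ i, h i = s}.Finite :=
    (Set.finite_Iic (l + n)).subset (by rintro _ ⟨h, ha, rfl⟩; exact ha.sum_le)
  obtain ⟨_, ⟨h, ha, rfl⟩, hmax⟩ := Set.exists_max_image _ id hfin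
    ⟨_, 0, IdentModel.Model.requirementA_zero, rfl⟩
  refine ⟨h, ha, fun i hi => ?_⟩
  have := hmax _ ⟨_, hi, rfl⟩
  simp [Finset.sum_add_distrib] at this
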